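/- Let $\mathcal W\subset\{w\in\mathbb C:|w|\le 1\}$ be a nonempty compact set of feasible beamforming coefficients. For $N\ge 0$ and a channel $h=(h_1,\dots,h_N)\in\mathbb C^N$ put $$g_{\mathcal W}(h)=\max_{w\in\mathcal W^N}\Big|\sum_{n=1}^N w_nh_n\Big|,\qquad g_{\rm ideal}(h)=\sum_{n=1}^N|h_n| ,$$ the latter being the maximum of $\big|\sum_n w_nh_n\big|$ over all $w$ with $|w_1|=\dots=|w_N|=1$. For a nonempty compact $S\subset\mathbb C$ let $H_S(\theta)=\max_{w\in S}\operatorname{Re}(e^{-i\theta}w)$, and let the mean width of $S$ be $\frac1{2\pi}\int_0^{2\pi}\big(H_S(\theta)+H_S(\theta+\pi)\big)\,d\theta$. The perimeter of a compact convex set is the arc length of its boundary, i.e. the supremum of the lengths of the closed convex polygons with vertices on the boundary (so the perimeter of a segment is twice its length, and that of a point is $0$). Write $P$ for the perimeter of $\operatorname{Conv}\mathcal W$, the convex hull of $\mathcal W$. Then: 1. the mean width of $\operatorname{Conv}\mathcal W$ equals $P/\pi$, and $$\frac1{2\pi}\int_0^{2\pi}\max_{w\in\mathcal W}\operatorname{Re}(e^{-i\theta}w)\,d\theta=\frac{P}{2\pi};$$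 2. for every $N$ and every $h\in\mathbb C^N$, both maxima above are attained and $$g_{\mathcal W}(h)\ \ge\ \frac{P}{2\pi}\; g_{\rm ideal}(h);$$ 3. the worst-case shortfall in dB equals $20\log_{10}(P/2\pi)$, that is, $$\inf_{N,\;h\in\mathbb C^N,\;h\ne0}\ 20\log_{10}\frac{g_{\mathcal W}(h)}{g_{\rm ideal}(h)}=20\log_{10}\frac{P}{2\pi},$$ with the convention $20\log_{10}0=-\infty$. -/

import Mathlib

noncomputable section

namespace Beamforming

/-- The set of all values `g(w) = |∑ n, w n * h n|` of the (amplitude) beamforming gain over the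
channel `h` when every coefficient `w n` is drawn from `W`. -/
def gains {N : ℕ} (W : Set ℂ) (h : Fin N → ℂ) : Set ℝ :=
  {g | ∃ w : Fin N → ℂ, (∀ n, w n ∈ W) ∧ g = ‖∑ n, w n * h n‖}

/-- The optimal beamforming gain `g_W`, the maximum of `|∑ n, w n * h n|` over `w ∈ W ^ N`. -/
def optimalGain {N : ℕ} (W : Set ℂ) (h : Fin N → ℂ) : ℝ :=
  sSup (gains W h)

/-- The gain `g_ideal = ∑ n, |h n|` with ideal phase shifters. -/
def idealGain {N : ℕ} (h : Fin N → ℂ) : ℝ :=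
  ∑ n, ‖h n‖

/-- The support function `z ↦ max_{w ∈ S} ⟨z, w⟩`, where `⟨z, w⟩ = Re (conj z * w)`. -/
def supportFn (S : Set ℂ) (z : ℂ) : ℝ :=
  sSup ((fun w : ℂ => inner ℝ z w) '' S)

/-- The width of `S` in the direction `θ`. -/
def width (S : Set ℂ) (θ : ℝ) : ℝ :=
  supportFn S (Complex.exp (θ * Complex.I)) +
    supportFn S (Complex.exp ((θ + Real.pi : ℝ) * Complex.I))

/-- The mean width of `S`: the average of the width over all directions. -/
def meanWidth (S : Set ℂ) : ℝ :=
  1 / (2 * Real.pi) * ∫ θ in (0 : ℝ)..(2 * Real.pi), width S θ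

/-- Twice the signed area of the triangle `a b c`; it is positive exactly when `a`, `b`, `c` are
the vertices of a nondegenerate triangle listed counterclockwise. -/
def orientation (a b c : ℂ) : ℝ :=
  (b - a).re * (c - a).im - (b - a).im * (c - a).re

/-- `p 0, …, p n` are the consecutive vertices of a strictly convex polygon, listed
counterclockwise. Up to two vertices (a point, or a segment traversed back and forth) the condition
is empty. -/
def IsConvexPolygon {n : ℕ} (p : Fin (n + 1) → ℂ) : Prop :=
  ∀ i j k : Fin (n + 1), i < j → j < k → 0 < orientation (p i) (p j) (p k)

/-- The length of the closed polygon `p 0, …, p n, p 0`; the index `i + 1` is cyclic. -/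
def polygonLength {n : ℕ} (p : Fin (n + 1) → ℂ) : ℝ :=
  ∑ i, ‖p (i + 1) - p i‖

/-- The perimeter of a compact convex set `S` in the plane: the arc length of its boundary, that
is, the supremum of the lengths of the closed convex polygons inscribed in the boundary. A
segment is its own boundary, traversed back and forth, so its perimeter is twice its length. -/
def perimeter (S : Set ℂ) : ℝ :=
  sSup {L | ∃ (n : ℕ) (p : Fin (n + 1) → ℂ),
    (∀ i, p i ∈ frontier S) ∧ IsConvexPolygon p ∧ L = polygonLength p}

/-- An amplitude ratio `r ≥ 0` in decibels, `20 log₁₀ r`, with value `-∞` at `r = 0`. -/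
def decibel (r : ℝ) : EReal :=
  if r ≤ 0 then ⊥ else ((20 * Real.logb 10 r : ℝ) : EReal)

end Beamforming

end

namespace Beamforming

lemma inner_eq_re_mul_re_add_im_mul_im (z w : ℂ) : inner ℝ z w = z.re * w.re + z.im * w.im := by
  simp [Complex.inner]; ring

lemma integral_abs_cos_sub (α : ℝ) :
    ∫ θ in (0 : ℝ)..(2 * Real.pi), |Real.cos (α - θ)| = 4 := by
  have hper : Function.Periodic (fun x => |Real.sin x|) Real.pi := fun x => by simp
  have hsin : ∫ x in (0 : ℝ)..Real.pi, |Real.sin x| = 2 := by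
    rw [intervalIntegral.integral_congr (g := Real.sin), integral_sin]
    · norm_num
    · intro x hx
      rw [Set.uIcc_of_le Real.pi_pos.le] at hx
      exact abs_of_nonneg (Real.sin_nonneg_of_mem_Icc hx)
  have hint : ∀ a b : ℝ, IntervalIntegrable (fun x => |Real.sin x|) MeasureTheory.volume a b :=
    fun a b => (by fun_prop : Continuous fun x => |Real.sin x|).intervalIntegrable a b
  have hshift : ∀ t : ℝ, ∫ x in t..(t + Real.pi), |Real.sin x| = 2 := fun t => by
    rw [hper.intervalIntegral_add_eq t 0, zero_add, hsin]
  have h1 : ∀ θ : ℝ, |Real.cos (α - θ)| = |Real.sin (α + Real.pi / 2 - θ)| := fun θ => by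
    rw [← Real.sin_add_pi_div_two]; ring_nf
  simp_rw [h1]
  rw [intervalIntegral.integral_comp_sub_left (fun x => |Real.sin x|),
    ← intervalIntegral.integral_add_adjacent_intervals (hint _ (α - Real.pi / 2)) (hint _ _)]
  have e1 := hshift (α + Real.pi / 2 - 2 * Real.pi)
  have e2 := hshift (α - Real.pi / 2)
  rw [show α + Real.pi / 2 - 2 * Real.pi + Real.pi = α - Real.pi / 2 by ring] at e1
  rw [show α - Real.pi / 2 + Real.pi = α + Real.pi / 2 - 0 by ring] at e2
  rw [e1, e2]; norm_num

lemma inner_exp (θ : ℝ) (z : ℂ) :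
    inner ℝ (Complex.exp (θ * Complex.I)) z = ‖z‖ * Real.cos (z.arg - θ) := by
  rw [inner_eq_re_mul_re_add_im_mul_im, Complex.exp_ofReal_mul_I_re, Complex.exp_ofReal_mul_I_im,
    Real.cos_sub, mul_add, ← mul_assoc, ← mul_assoc, Complex.norm_mul_cos_arg,
    Complex.norm_mul_sin_arg]
  ring

lemma integral_abs_inner_exp (z : ℂ) :
    ∫ θ in (0 : ℝ)..(2 * Real.pi), |(inner ℝ (Complex.exp (θ * Complex.I)) z : ℝ)| = 4 * ‖z‖ := by
  simp_rw [inner_exp, abs_mul, abs_norm]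
  rw [intervalIntegral.integral_const_mul, integral_abs_cos_sub, mul_comm]

/-- The total variation of a real-valued function along a closed cycle. -/
def cyclicVariation {n : ℕ} (a : Fin (n + 1) → ℝ) : ℝ := ∑ i, |a (i + 1) - a i|

lemma four_mul_polygonLength {n : ℕ} (p : Fin (n + 1) → ℂ) :
    4 * polygonLength p = ∫ θ in (0 : ℝ)..(2 * Real.pi),
      cyclicVariation fun i => (inner ℝ (Complex.exp (θ * Complex.I)) (p i) : ℝ) := by
  simp_rw [cyclicVariation, ← inner_sub_right]
  rw [intervalIntegral.integral_finsetSum]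
  · simp_rw [integral_abs_inner_exp, polygonLength, Finset.mul_sum]
  · intro i _
    exact (by fun_prop : Continuous fun θ : ℝ =>
      |(inner ℝ (Complex.exp (θ * Complex.I)) (p (i + 1) - p i) : ℝ)|).intervalIntegrable _ _

lemma cyclicVariation_eq {n : ℕ} (a : Fin (n + 1) → ℝ) :
    cyclicVariation a = ∑ i : Fin n, |a i.succ - a i.castSucc| + |a 0 - a (Fin.last n)| := by
  rw [cyclicVariation, Fin.sum_univ_castSucc]
  simp [Fin.coeSucc_eq_succ]

lemma cyclicVariation_succ {n : ℕ} (a : Fin (n + 2) → ℝ) :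
    cyclicVariation a = cyclicVariation (fun i : Fin (n + 1) => a i.castSucc) +
      (|a (Fin.last _) - a (Fin.last n).castSucc| + |a 0 - a (Fin.last _)| -
        |a 0 - a (Fin.last n).castSucc|) := by
  rw [cyclicVariation_eq, cyclicVariation_eq, Fin.sum_univ_castSucc]
  simp only [Fin.succ_last, Fin.castSucc_zero, Fin.succ_castSucc]
  ring

lemma two_mul_abs_sub_le_cyclicVariation {n : ℕ} (a : Fin (n + 1) → ℝ) (i j : Fin (n + 1)) :
    2 * |a i - a j| ≤ cyclicVariation a := by
  wlog hij : i ≤ j generalizing i j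
  · rw [abs_sub_comm]; exact this j i (le_of_not_ge hij)
  have hcast : ∀ k : Fin (n + 1), Fin.ofNat (n + 1) k = k := fun k =>
    Fin.ext (Nat.mod_eq_of_lt k.2)
  have hsucc : ∀ k : Fin (n + 1), Fin.ofNat (n + 1) (k + 1) = k + 1 := fun k => by
    apply Fin.ext; simp [Fin.val_add]
  set q : ℕ → ℝ := fun k => a (Fin.ofNat (n + 1) k) with hq
  have hsum : cyclicVariation a = ∑ k ∈ Finset.range (n + 1), dist (q k) (q (k + 1)) := by
    rw [← Fin.sum_univ_eq_sum_range (fun k => dist (q k) (q (k + 1))), cyclicVariation]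
    refine Finset.sum_congr rfl fun k _ => ?_
    simp only [hq, hcast, hsucc, Real.dist_eq, abs_sub_comm]
  have h1 := dist_le_Ico_sum_dist q (Nat.zero_le i)
  have h2 := dist_le_Ico_sum_dist q (Fin.le_def.1 hij)
  have h3 := dist_le_Ico_sum_dist q (j.2.le)
  have h4 := Finset.sum_Ico_consecutive (fun k => dist (q k) (q (k + 1))) (Nat.zero_le i)
    (Fin.le_def.1 hij)
  have h5 := Finset.sum_Ico_consecutive (fun k => dist (q k) (q (k + 1))) (Nat.zero_le j) j.2.le
  have hi : q i = a i := by simp only [hq, hcast]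
  have hj : q j = a j := by simp only [hq, hcast]
  have h0 : q (n + 1) = q 0 := by
    have : Fin.ofNat (n + 1) (n + 1) = Fin.ofNat (n + 1) 0 := by apply Fin.ext; simp
    simp only [hq, this]
  simp only [hi, hj, h0] at h1 h2 h3
  rw [hsum, Finset.range_eq_Ico]
  have h6 := dist_triangle (a j) (q 0) (a i)
  rw [dist_comm (a j) (a i)] at h6
  rw [← Real.dist_eq]
  linarith

lemma cyclicVariation_neg {n : ℕ} (a : Fin (n + 1) → ℝ) :
    cyclicVariation (fun i => -a i) = cyclicVariation a := by
  refine Finset.sum_congr rfl fun i _ => ?_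
  rw [← abs_neg]; ring_nf

/-- The affine dependence between four points of the plane. -/
lemma orientation_mul_inner (u a b c d : ℂ) :
    orientation b c d * inner ℝ u a + orientation a b d * inner ℝ u c =
      orientation a c d * inner ℝ u b + orientation a b c * inner ℝ u d := by
  simp only [inner_eq_re_mul_re_add_im_mul_im, orientation, Complex.sub_re, Complex.sub_im]
  ring

lemma orientation_add_eq (a b c d : ℂ) :
    orientation b c d + orientation a b d = orientation a c d + orientation a b c := by
  simp only [orientation, Complex.sub_re, Complex.sub_im]
  ring

lemma IsConvexPolygon.castSucc {n : ℕ} {p : Fin (n + 2) → ℂ} (hp : IsConvexPolygon p) :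
    IsConvexPolygon fun i : Fin (n + 1) => p i.castSucc :=
  fun _ _ _ hij hjk => hp _ _ _ (Fin.castSucc_lt_castSucc_iff.2 hij)
    (Fin.castSucc_lt_castSucc_iff.2 hjk)

/-- If the last vertex is the highest among its neighbours, then no vertex other than it is above
both neighbours. -/
lemma IsConvexPolygon.inner_le_max {n : ℕ} {p : Fin (n + 2) → ℂ} (hp : IsConvexPolygon p) (u : ℂ)
    (h : max (inner ℝ u (p 0) : ℝ) (inner ℝ u (p (Fin.last n).castSucc)) <
      inner ℝ u (p (Fin.last _))) (j : Fin (n + 1)) :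
    inner ℝ u (p j.castSucc) ≤
      max (inner ℝ u (p 0) : ℝ) (inner ℝ u (p (Fin.last n).castSucc)) := by
  rcases eq_or_ne j 0 with rfl | hj0
  · exact le_max_left _ _
  rcases eq_or_ne j (Fin.last n) with rfl | hjn
  · exact le_max_right _ _
  have h0 : (0 : Fin (n + 2)) < j.castSucc := by
    rw [Fin.lt_def]; simpa [Fin.pos_iff_ne_zero] using Fin.pos_iff_ne_zero.2 hj0
  have h1 : j.castSucc < (Fin.last n).castSucc :=
    Fin.castSucc_lt_castSucc_iff.2 (Fin.lt_last_iff_ne_last.2 hjn)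
  have h2 : (Fin.last n).castSucc < Fin.last (n + 1) := Fin.castSucc_lt_last _
  have i1 := hp _ _ _ h0 h1
  have i2 := hp _ _ _ h1 h2
  have i3 := hp _ _ _ h0 (h1.trans h2)
  have i4 := hp _ _ _ (h0.trans h1) h2
  have e1 := orientation_mul_inner u (p 0) (p j.castSucc) (p (Fin.last n).castSucc)
    (p (Fin.last _))
  have e2 := orientation_add_eq (p 0) (p j.castSucc) (p (Fin.last n).castSucc) (p (Fin.last _))
  set M := max (inner ℝ u (p 0) : ℝ) (inner ℝ u (p (Fin.last n).castSucc))
  have l1 : inner ℝ u (p 0) ≤ M := le_max_left _ _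
  have l2 : inner ℝ u (p (Fin.last n).castSucc) ≤ M := le_max_right _ _
  by_contra! hlt
  have k1 := mul_le_mul_of_nonneg_left l1 i2.le
  have k2 := mul_le_mul_of_nonneg_left l2 i3.le
  have k3 := mul_lt_mul_of_pos_left hlt i4
  have k4 := mul_lt_mul_of_pos_left h i1
  have k5 := congrArg (· * M) e2
  simp only [add_mul] at k5
  linarith

lemma IsConvexPolygon.cyclicVariation_le {n : ℕ} {p : Fin (n + 1) → ℂ} (hp : IsConvexPolygon p)
    (u : ℂ) {m M : ℝ} (hm : ∀ i, m ≤ inner ℝ u (p i)) (hM : ∀ i, inner ℝ u (p i) ≤ M) :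
    cyclicVariation (fun i => (inner ℝ u (p i) : ℝ)) ≤ 2 * (M - m) := by
  induction n generalizing u m M with
  | zero =>
    have h1 := hm 0
    have h2 := hM 0
    simp [cyclicVariation]
    linarith
  | succ n ih =>
    have key : ∀ (u : ℂ) (m M : ℝ), (∀ i, m ≤ inner ℝ u (p i)) → (∀ i, inner ℝ u (p i) ≤ M) →
        max (inner ℝ u (p 0) : ℝ) (inner ℝ u (p (Fin.last n).castSucc)) <
          inner ℝ u (p (Fin.last _)) →
        cyclicVariation (fun i => (inner ℝ u (p i) : ℝ)) ≤ 2 * (M - m) := by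
      intro u m M hm hM h
      have h1 := ih hp.castSucc u (fun i => hm _) (hp.inner_le_max u h)
      have h2 := hM (Fin.last _)
      rw [cyclicVariation_succ]
      rw [max_def] at *
      split_ifs at * with hle
      · rw [abs_of_pos (sub_pos.2 h), abs_of_neg (by linarith), abs_of_nonpos (by linarith)]
        linarith
      · rw [abs_of_pos (by linarith), abs_of_neg (by linarith), abs_of_nonneg (by linarith)]
        linarith
    by_cases h1 : max (inner ℝ u (p 0) : ℝ) (inner ℝ u (p (Fin.last n).castSucc)) <
        inner ℝ u (p (Fin.last _))
    · exact key u m M hm hM h1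
    by_cases h2 : max (inner ℝ (-u) (p 0) : ℝ) (inner ℝ (-u) (p (Fin.last n).castSucc)) <
        inner ℝ (-u) (p (Fin.last _))
    · have := key (-u) (-M) (-m) (fun i => by rw [inner_neg_left]; linarith [hM i])
        (fun i => by rw [inner_neg_left]; linarith [hm i]) h2
      simp only [inner_neg_left] at this
      rw [cyclicVariation_neg] at this
      linarith
    have h3 := ih hp.castSucc u (fun i => hm _) (fun i => hM _)
    rw [cyclicVariation_succ]
    simp only [inner_neg_left, max_lt_iff, neg_lt_neg_iff] at h1 h2
    refine le_trans (add_le_of_nonpos_right ?_) h3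
    rcases le_total (inner ℝ u (p 0) : ℝ) (inner ℝ u (p (Fin.last n).castSucc)) with hle | hle
    · have l1 : (inner ℝ u (p (Fin.last _)) : ℝ) ≤ inner ℝ u (p (Fin.last n).castSucc) := by
        by_contra! hc; exact h1 ⟨hle.trans_lt hc, hc⟩
      have l2 : (inner ℝ u (p 0) : ℝ) ≤ inner ℝ u (p (Fin.last _)) := by
        by_contra! hc; exact h2 ⟨hc, hc.trans_le hle⟩
      rw [abs_of_nonpos (by linarith), abs_of_nonpos (by linarith), abs_of_nonpos (by linarith)]
      linarith
    · have l1 : (inner ℝ u (p (Fin.last _)) : ℝ) ≤ inner ℝ u (p 0) := by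
        by_contra! hc; exact h1 ⟨hc, hle.trans_lt hc⟩
      have l2 : (inner ℝ u (p (Fin.last n).castSucc) : ℝ) ≤ inner ℝ u (p (Fin.last _)) := by
        by_contra! hc; exact h2 ⟨hc.trans_le hle, hc⟩
      rw [abs_of_nonneg (by linarith), abs_of_nonneg (by linarith), abs_of_nonneg (by linarith)]
      linarith

/-- A finite set has a convexly independent subset with the same convex hull. -/
lemma exists_subset_convexIndependent (F : Finset ℂ) :
    ∃ E : Finset ℂ, E ⊆ F ∧ (F : Set ℂ) ⊆ convexHull ℝ (E : Set ℂ) ∧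
      ∀ x ∈ E, x ∉ convexHull ℝ ((E : Set ℂ) \ {x}) := by
  induction F using Finset.strongInduction with
  | _ F ih =>
    by_cases h : ∀ x ∈ F, x ∉ convexHull ℝ ((F : Set ℂ) \ {x})
    · exact ⟨F, subset_rfl, subset_convexHull ℝ _, h⟩
    push Not at h
    obtain ⟨x, hx, hxF⟩ := h
    obtain ⟨E, hE, hFE, hind⟩ := ih (F.erase x) (Finset.erase_ssubset hx)
    refine ⟨E, hE.trans (Finset.erase_subset _ _), fun y hy => ?_, hind⟩
    rw [Finset.coe_erase] at hFE
    by_cases hyx : y = x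
    · subst hyx
      exact convexHull_min hFE (convex_convexHull ℝ _) hxF
    · exact hFE ⟨hy, hyx⟩

lemma orientation_pos_of_arg_lt {v a b : ℂ} (ha : a ≠ v) (hb : b ≠ v)
    (ha' : -(Real.pi / 2) < (a - v).arg) (hb' : (b - v).arg ≤ Real.pi / 2)
    (hab : (a - v).arg < (b - v).arg) : 0 < orientation v a b := by
  have h : orientation v a b = ‖a - v‖ * ‖b - v‖ * Real.sin ((b - v).arg - (a - v).arg) := by
    rw [orientation, Real.sin_sub, ← Complex.norm_mul_cos_arg (a - v),
      ← Complex.norm_mul_cos_arg (b - v), ← Complex.norm_mul_sin_arg (a - v),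
      ← Complex.norm_mul_sin_arg (b - v)]
    ring
  rw [h]
  have h1 := norm_pos_iff.2 (sub_ne_zero.2 ha)
  have h2 := norm_pos_iff.2 (sub_ne_zero.2 hb)
  have h3 := Real.sin_pos_of_pos_of_lt_pi (sub_pos.2 hab) (by linarith)
  positivity

/-- A point seen from `v` in the same direction as another one is in the convex hull of the other
one and `v`, or vice versa. -/
lemma mem_segment_of_arg_eq {v a b : ℂ} (hb : b ≠ v)
    (hab : (a - v).arg = (b - v).arg) (hle : ‖a - v‖ ≤ ‖b - v‖) : a ∈ segment ℝ v b := by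
  have h2 := norm_pos_iff.2 (sub_ne_zero.2 hb)
  rw [segment_eq_image_lineMap]
  refine ⟨‖a - v‖ / ‖b - v‖, ⟨by positivity, (div_le_one h2).2 hle⟩, ?_⟩
  have h1 : (a - v) * ‖b - v‖ = ‖a - v‖ * (b - v) := by
    conv_lhs => rw [← Complex.norm_mul_exp_arg_mul_I (a - v)]
    conv_rhs => rw [← Complex.norm_mul_exp_arg_mul_I (b - v)]
    rw [hab]; ring
  have h4 : (‖b - v‖ : ℂ) ≠ 0 := by exact_mod_cast h2.ne'
  rw [AffineMap.lineMap_apply, vsub_eq_sub, vadd_eq_add, ← eq_sub_iff_add_eq, Complex.real_smul]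
  push_cast
  rw [div_mul_eq_mul_div, ← h1, mul_div_cancel_right₀ _ h4]

lemma exists_isConvexPolygon (F : Finset ℂ) (hF : F.Nonempty) :
    ∃ (n : ℕ) (p : Fin (n + 1) → ℂ), IsConvexPolygon p ∧ (∀ i, p i ∈ F) ∧
      (F : Set ℂ) ⊆ convexHull ℝ (Set.range p) := by
  obtain ⟨E, hEF, hFE, hind⟩ := exists_subset_convexIndependent F
  have hE : E.Nonempty := by
    rw [Finset.nonempty_iff_ne_empty]
    rintro rfl
    obtain ⟨x, hx⟩ := hF
    simpa using hFE hx
  obtain ⟨v, hvE, hv⟩ := E.exists_min_image (fun z => toLex (z.re, z.im)) hE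
  have hnotmem : ∀ x ∈ E, ∀ S : Set ℂ, S ⊆ E → x ∉ S → x ∉ convexHull ℝ S := fun x hx S hS hxS h =>
    hind x hx (convexHull_mono (Set.subset_sdiff_singleton hS hxS) h)
  have hre : ∀ x ∈ E, x ≠ v → 0 ≤ (x - v).re ∧ -(Real.pi / 2) < (x - v).arg ∧
      (x - v).arg ≤ Real.pi / 2 := by
    intro x hx hxv
    have h1 := hv x hx
    rw [Prod.Lex.toLex_le_toLex] at h1
    have h0 : 0 ≤ (x - v).re := by
      rw [Complex.sub_re]; rcases h1 with h | h
      · exact sub_nonneg.2 h.le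
      · exact sub_nonneg.2 h.1.le
    have h2 := abs_le.1 (Complex.abs_arg_le_pi_div_two_iff.2 h0)
    refine ⟨h0, lt_of_le_of_ne h2.1 fun heq => ?_, h2.2⟩
    rw [eq_comm, Complex.arg_eq_neg_pi_div_two_iff, Complex.sub_re, Complex.sub_im] at heq
    rcases h1 with h | h
    · simp only at h; linarith
    · simp only at h; linarith
  have hinj : Set.InjOn (fun x : ℂ => (x - v).arg) (E.erase v : Finset ℂ) := by
    have key : ∀ a ∈ E.erase v, ∀ b ∈ E.erase v, (a - v).arg = (b - v).arg →
        ‖a - v‖ ≤ ‖b - v‖ → a = b := by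
      intro a ha b hb hab hle
      by_contra hne
      rw [Finset.mem_erase] at ha hb
      refine hnotmem a ha.2 {v, b} ?_ (by simp [hne, ha.1]) ?_
      · rintro x (rfl | rfl)
        exacts [hvE, hb.2]
      · rw [convexHull_pair]
        exact mem_segment_of_arg_eq hb.1 hab hle
    intro a ha b hb hab
    rcases le_total ‖a - v‖ ‖b - v‖ with h | h
    · exact key a ha b hb hab h
    · exact (key b hb a ha hab.symm h).symm
  set A : Finset ℝ := (E.erase v).image fun x => (x - v).arg with hA
  have hmem : ∀ i : Fin A.card, ∃ x ∈ E.erase v, (x - v).arg = A.orderEmbOfFin rfl i := fun i =>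
    Finset.mem_image.1 (A.orderEmbOfFin_mem rfl i)
  choose q hqE hqarg using hmem
  have hq : ∀ i, q i ∈ E := fun i => Finset.mem_of_mem_erase (hqE i)
  have hqv : ∀ i, q i ≠ v := fun i => Finset.ne_of_mem_erase (hqE i)
  have hor : ∀ i j, i < j → 0 < orientation v (q i) (q j) := fun i j hij =>
    orientation_pos_of_arg_lt (hqv i) (hqv j) (hre _ (hq i) (hqv i)).2.1 (hre _ (hq j) (hqv j)).2.2
      (by rw [hqarg, hqarg]; exact (A.orderEmbOfFin rfl).strictMono hij)
  have hqinj : ∀ i j, i ≠ j → q i ≠ q j := fun i j hij h => hij <|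
    (A.orderEmbOfFin rfl).injective (by rw [← hqarg, ← hqarg, h])
  refine ⟨A.card, Fin.cons v q, ?_, ?_, ?_⟩
  · intro i j k hij hjk
    obtain ⟨j, rfl⟩ := Fin.exists_succ_eq.2 (Fin.ne_zero_of_lt hij)
    obtain ⟨k, rfl⟩ := Fin.exists_succ_eq.2 (Fin.ne_zero_of_lt hjk)
    rw [Fin.succ_lt_succ_iff] at hjk
    rcases Fin.eq_zero_or_eq_succ i with rfl | ⟨i, rfl⟩
    · simpa using hor j k hjk
    rw [Fin.succ_lt_succ_iff] at hij
    simp only [Fin.cons_succ]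
    by_contra! hneg
    refine hnotmem (q j) (hq j) {v, q i, q k} ?_
      (by simp [hqv j, hqinj j i hij.ne', hqinj j k hjk.ne]) ?_
    · rintro x (rfl | rfl | rfl)
      exacts [hvE, hq i, hq k]
    have o1 := hor i j hij
    have o2 := hor j k hjk
    have o3 := hor i k (hij.trans hjk)
    have hsum := orientation_add_eq v (q i) (q j) (q k)
    have hcomb : (-orientation (q i) (q j) (q k) / orientation v (q i) (q k)) • v +
        (orientation v (q j) (q k) / orientation v (q i) (q k)) • q i +
        (orientation v (q i) (q j) / orientation v (q i) (q k)) • q k = q j := by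
      have hc : (orientation v (q i) (q k)) ≠ 0 := o3.ne'
      apply Complex.ext <;>
      · simp only [Complex.add_re, Complex.add_im, Complex.smul_re, Complex.smul_im, smul_eq_mul]
        field_simp
        simp only [orientation, Complex.sub_re, Complex.sub_im]
        ring
    rw [← hcomb]
    have hconv := convex_convexHull ℝ ({v, q i, q k} : Set ℂ)
    have hmem := subset_convexHull ℝ ({v, q i, q k} : Set ℂ)
    have := hconv.sum_mem (t := Finset.univ) (w := ![-orientation (q i) (q j) (q k) /
      orientation v (q i) (q k), orientation v (q j) (q k) / orientation v (q i) (q k),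
      orientation v (q i) (q j) / orientation v (q i) (q k)]) (z := ![v, q i, q k])
    simp only [Fin.sum_univ_three, Finset.mem_univ, forall_true_left, Fin.forall_fin_succ,
      Matrix.cons_val] at this
    refine this ⟨div_nonneg (by linarith) o3.le, (div_pos o2 o3).le, (div_pos o1 o3).le, by simp⟩ ?_
      ⟨hmem (by simp), hmem (by simp), hmem (by simp), by simp⟩
    rw [← add_div, ← add_div, div_eq_one_iff_eq o3.ne']
    linarith
  · intro i
    refine hEF ?_
    rcases Fin.eq_zero_or_eq_succ i with rfl | ⟨i, rfl⟩
    · simpa using hvE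
    · simpa using hq i
  · refine hFE.trans (convexHull_mono fun x hx => ?_)
    rcases eq_or_ne x v with rfl | hxv
    · exact ⟨0, by simp⟩
    have hxE : x ∈ E.erase v := Finset.mem_erase.2 ⟨hxv, hx⟩
    have hxA : (x - v).arg ∈ A := Finset.mem_image_of_mem _ hxE
    rw [← Finset.mem_coe, ← A.range_orderEmbOfFin rfl] at hxA
    obtain ⟨i, hi⟩ := hxA
    refine ⟨i.succ, ?_⟩
    rw [Fin.cons_succ]
    exact hinj (hqE i) hxE (by simp only [hqarg, hi])

end Beamforming

/-- In finite dimension the convex hull of a compact set is compact. -/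
theorem IsCompact.convexHull_real
    {E : Type*} [NormedAddCommGroup E] [NormedSpace ℝ E]
    [FiniteDimensional ℝ E] {S : Set E} (hS : IsCompact S) : IsCompact (convexHull ℝ S) := by
  set d := Module.finrank ℝ E + 1
  have himage : convexHull ℝ S = (fun q : (Fin d → ℝ) × (Fin d → E) => ∑ i, q.1 i • q.2 i) ''
      (stdSimplex ℝ (Fin d) ×ˢ Set.univ.pi fun _ => S) := by
    ext x
    constructor
    · intro hx
      rw [convexHull_eq_union] at hx
      simp only [Set.mem_iUnion] at hx
      obtain ⟨t, htS, hind, hxt⟩ := hx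
      have hne : Nonempty t := by
        obtain ⟨y, hy⟩ := convexHull_nonempty_iff.1 ⟨x, hxt⟩
        exact ⟨⟨y, hy⟩⟩
      have hcard : Fintype.card t ≤ Fintype.card (Fin d) := by
        rw [Fintype.card_fin]
        exact hind.card_le_finrank_succ.trans (Nat.succ_le_succ (Submodule.finrank_le _))
      obtain ⟨⟨e, he⟩⟩ := Function.Embedding.nonempty_of_card_le hcard
      have hsurj := Function.invFun_surjective he
      set f : Fin d → E := fun i => ((Function.invFun e i : t) : E) with hf
      have hrange : (t : Set E) = Set.range f := by
        ext y
        constructor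
        · intro hy
          obtain ⟨i, hi⟩ := hsurj ⟨y, hy⟩
          exact ⟨i, by rw [hf]; simp only [hi]⟩
        · rintro ⟨i, rfl⟩
          exact (Function.invFun e i).2
      have hsub : convexHull ℝ (Set.range f) ⊆
          (Fintype.linearCombination ℝ f) '' stdSimplex ℝ (Fin d) := by
        refine convexHull_min ?_ ((convex_stdSimplex ℝ (Fin d)).linear_image _)
        rintro _ ⟨i, rfl⟩
        exact ⟨Pi.single i 1, single_mem_stdSimplex ℝ i, by
          simp [Fintype.linearCombination_apply_single]⟩
      obtain ⟨w, hw, rfl⟩ := hsub (hrange ▸ hxt)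
      exact ⟨(w, f), ⟨hw, fun i _ => htS (Function.invFun e i).2⟩,
        (Fintype.linearCombination_apply ℝ f w).symm⟩
    · rintro ⟨⟨w, z⟩, ⟨hw, hz⟩, rfl⟩
      exact (convex_convexHull ℝ S).sum_mem (fun i _ => hw.1 i) hw.2 fun i _ =>
        subset_convexHull ℝ S (hz i trivial)
  rw [himage]
  exact ((isCompact_stdSimplex ℝ _).prod (isCompact_univ_pi fun _ => hS)).image (by fun_prop)

namespace Beamforming

section SupportFunction

variable {S : Set ℂ}

lemma isGreatest_supportFn (hS : IsCompact S) (hne : S.Nonempty) (z : ℂ) :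
    IsGreatest ((fun w : ℂ => (inner ℝ z w : ℝ)) '' S) (supportFn S z) :=
  (hS.image (by fun_prop)).isGreatest_sSup (hne.image _)

lemma inner_le_supportFn (hS : IsCompact S) {w : ℂ} (hw : w ∈ S) (z : ℂ) :
    inner ℝ z w ≤ supportFn S z :=
  (isGreatest_supportFn hS ⟨w, hw⟩ z).2 ⟨w, hw, rfl⟩

lemma exists_inner_eq_supportFn (hS : IsCompact S) (hne : S.Nonempty) (z : ℂ) :
    ∃ w ∈ S, inner ℝ z w = supportFn S z :=
  (isGreatest_supportFn hS hne z).1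

lemma inner_le_of_mem_convexHull {z x : ℂ} {c : ℝ} (hc : ∀ w ∈ S, inner ℝ z w ≤ c)
    (hx : x ∈ convexHull ℝ S) : inner ℝ z x ≤ c :=
  convexHull_min (t := {w | (inner ℝ z w : ℝ) ≤ c}) hc
    (convex_halfSpace_le (innerₗ ℂ z).isLinear c) hx

lemma supportFn_convexHull (hS : IsCompact S) (hne : S.Nonempty) (z : ℂ) :
    supportFn (convexHull ℝ S) z = supportFn S z := by
  refine le_antisymm ?_ ?_
  · obtain ⟨x, hx, hxz⟩ := exists_inner_eq_supportFn hS.convexHull_real hne.convexHull z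
    rw [← hxz]
    exact inner_le_of_mem_convexHull (fun w hw => inner_le_supportFn hS hw z) hx
  · obtain ⟨x, hx, hxz⟩ := exists_inner_eq_supportFn hS hne z
    rw [← hxz]
    exact inner_le_supportFn hS.convexHull_real (subset_convexHull ℝ S hx) z

lemma continuous_supportFn (hS : IsCompact S) : Continuous (supportFn S) :=
  hS.continuous_sSup (f := fun z w => (inner ℝ z w : ℝ)) (by fun_prop)

lemma continuous_supportFn_exp (hS : IsCompact S) :
    Continuous fun θ : ℝ => supportFn S (Complex.exp (θ * Complex.I)) :=
  (continuous_supportFn hS).comp (by fun_prop)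

lemma exp_add_pi (θ : ℝ) : Complex.exp ((θ + Real.pi : ℝ) * Complex.I) =
    -Complex.exp (θ * Complex.I) := by
  rw [Complex.ofReal_add, add_mul, Complex.exp_add, Complex.exp_pi_mul_I, mul_neg_one]

lemma supportFn_exp_periodic (S : Set ℂ) :
    Function.Periodic (fun θ : ℝ => supportFn S (Complex.exp (θ * Complex.I))) (2 * Real.pi) := by
  intro θ
  simp only
  rw [show θ + 2 * Real.pi = θ + Real.pi + Real.pi by ring, exp_add_pi, exp_add_pi, neg_neg]

lemma integral_supportFn_exp_of_period (S : Set ℂ) (t : ℝ) :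
    ∫ θ in t..(t + 2 * Real.pi), supportFn S (Complex.exp (θ * Complex.I)) =
      ∫ θ in (0 : ℝ)..(2 * Real.pi), supportFn S (Complex.exp (θ * Complex.I)) := by
  simpa using (supportFn_exp_periodic S).intervalIntegral_add_eq t 0

lemma integral_supportFn_exp_add (S : Set ℂ) (t : ℝ) :
    ∫ θ in (0 : ℝ)..(2 * Real.pi), supportFn S (Complex.exp ((θ + t : ℝ) * Complex.I)) =
      ∫ θ in (0 : ℝ)..(2 * Real.pi), supportFn S (Complex.exp (θ * Complex.I)) := by
  rw [intervalIntegral.integral_comp_add_right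
    (fun θ : ℝ => supportFn S (Complex.exp (θ * Complex.I))), zero_add, add_comm,
    integral_supportFn_exp_of_period]

lemma continuous_width (hS : IsCompact S) : Continuous (width S) :=
  (continuous_supportFn_exp hS).add
    ((continuous_supportFn_exp hS).comp (continuous_add_const Real.pi))

lemma integral_width (hS : IsCompact S) :
    ∫ θ in (0 : ℝ)..(2 * Real.pi), width S θ =
      2 * ∫ θ in (0 : ℝ)..(2 * Real.pi), supportFn S (Complex.exp (θ * Complex.I)) := by
  have h1 := continuous_supportFn_exp hS
  have h2 : Continuous fun θ : ℝ => supportFn S (Complex.exp ((θ + Real.pi : ℝ) * Complex.I)) :=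
    h1.comp (continuous_add_const Real.pi)
  simp only [width]
  rw [intervalIntegral.integral_add (h1.intervalIntegrable _ _) (h2.intervalIntegrable _ _),
    integral_supportFn_exp_add, ← two_mul]

lemma exists_frontier_inner_eq_supportFn (hS : IsCompact S) (hne : S.Nonempty) {z : ℂ}
    (hz : z ≠ 0) : ∃ w ∈ frontier S, inner ℝ z w = supportFn S z := by
  obtain ⟨w, hw, hwz⟩ := exists_inner_eq_supportFn hS hne z
  refine ⟨w, ?_, hwz⟩
  rw [hS.isClosed.frontier_eq]
  refine ⟨hw, fun hint => ?_⟩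
  obtain ⟨δ, hδ, hball⟩ := Metric.isOpen_iff.1 isOpen_interior w hint
  have hz' := norm_pos_iff.2 hz
  have hmem : w + (δ / (2 * ‖z‖)) • z ∈ S := interior_subset <| hball <| by
    rw [mem_ball_iff_norm, add_sub_cancel_left, norm_smul, Real.norm_of_nonneg (by positivity)]
    rw [div_mul_eq_mul_div, div_lt_iff₀ (by positivity)]
    nlinarith
  have h := inner_le_supportFn hS hmem z
  rw [inner_add_right, inner_smul_right, hwz, real_inner_self_eq_norm_sq] at h
  have : 0 < δ / (2 * ‖z‖) * ‖z‖ ^ 2 := by positivity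
  linarith

end SupportFunction

section Perimeter

variable {S : Set ℂ}

lemma continuous_cyclicVariation_inner {n : ℕ} (p : Fin (n + 1) → ℂ) :
    Continuous fun θ : ℝ =>
      cyclicVariation fun i => (inner ℝ (Complex.exp (θ * Complex.I)) (p i) : ℝ) := by
  unfold cyclicVariation
  fun_prop

lemma IsConvexPolygon.polygonLength_le (hS : IsCompact S) {n : ℕ} {p : Fin (n + 1) → ℂ}
    (hp : IsConvexPolygon p) (hpS : ∀ i, p i ∈ S) :
    polygonLength p ≤
      ∫ θ in (0 : ℝ)..(2 * Real.pi), supportFn S (Complex.exp (θ * Complex.I)) := by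
  have h : 4 * polygonLength p ≤ ∫ θ in (0 : ℝ)..(2 * Real.pi), 2 * width S θ := by
    rw [four_mul_polygonLength]
    refine intervalIntegral.integral_mono_on (by positivity)
      ((continuous_cyclicVariation_inner p).intervalIntegrable _ _)
      ((continuous_width hS).const_mul 2 |>.intervalIntegrable _ _) fun θ _ => ?_
    rw [width, exp_add_pi, ← sub_neg_eq_add]
    refine hp.cyclicVariation_le _ (fun i => ?_) fun i => inner_le_supportFn hS (hpS i) _
    have := inner_le_supportFn hS (hpS i) (-Complex.exp (θ * Complex.I))
    rw [inner_neg_left] at this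
    linarith
  rw [intervalIntegral.integral_const_mul, integral_width hS] at h
  linarith

lemma exists_isConvexPolygon_le_polygonLength (hS : IsCompact S) (hne : S.Nonempty) {ε : ℝ}
    (hε : 0 < ε) : ∃ (n : ℕ) (p : Fin (n + 1) → ℂ),
      (∀ i, p i ∈ frontier S) ∧ IsConvexPolygon p ∧
      (∫ θ in (0 : ℝ)..(2 * Real.pi), supportFn S (Complex.exp (θ * Complex.I))) -
        2 * Real.pi * ε ≤ polygonLength p := by
  have hfr : IsCompact (frontier S) := hS.of_isClosed_subset isClosed_frontier
    hS.isClosed.frontier_subset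
  obtain ⟨F, hFS, hF, hcover⟩ := hfr.finite_cover_balls hε
  lift F to Finset ℂ using hF
  have happrox : ∀ θ : ℝ, ∃ y ∈ F, supportFn S (Complex.exp (θ * Complex.I)) - ε ≤
      inner ℝ (Complex.exp (θ * Complex.I)) y := by
    intro θ
    obtain ⟨w, hw, hwθ⟩ := exists_frontier_inner_eq_supportFn hS hne
      (Complex.exp_ne_zero (θ * Complex.I))
    obtain ⟨y, hy, hwy⟩ := Set.mem_iUnion₂.1 (hcover hw)
    refine ⟨y, hy, ?_⟩
    have h := real_inner_le_norm (Complex.exp (θ * Complex.I)) (w - y)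
    rw [Complex.norm_exp_ofReal_mul_I, one_mul, inner_sub_right, hwθ] at h
    have := mem_ball_iff_norm.1 hwy
    linarith
  obtain ⟨n, p, hp, hpF, hFp⟩ := exists_isConvexPolygon F (by
    obtain ⟨y, hy, -⟩ := happrox 0
    exact ⟨y, hy⟩)
  refine ⟨n, p, fun i => hFS (hpF i), hp, ?_⟩
  have hvertex : ∀ θ : ℝ, ∃ i, supportFn S (Complex.exp (θ * Complex.I)) - ε ≤
      inner ℝ (Complex.exp (θ * Complex.I)) (p i) := by
    intro θ
    obtain ⟨y, hy, hyθ⟩ := happrox θ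
    by_contra! hlt
    obtain ⟨_, ⟨i, rfl⟩, hi⟩ := exists_inner_eq_supportFn (Set.finite_range p).isCompact
      (Set.range_nonempty p) (Complex.exp (θ * Complex.I))
    have := inner_le_of_mem_convexHull (z := Complex.exp (θ * Complex.I))
      (fun w hw => inner_le_supportFn (Set.finite_range p).isCompact hw _) (hFp hy)
    exact absurd (hyθ.trans this) (not_le.2 (hi ▸ hlt i))
  have h : ∫ θ in (0 : ℝ)..(2 * Real.pi), 2 * (width S θ - 2 * ε) ≤ 4 * polygonLength p := by
    rw [four_mul_polygonLength]
    refine intervalIntegral.integral_mono_on (by positivity)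
      (((continuous_width hS).sub continuous_const).const_mul 2 |>.intervalIntegrable _ _)
      ((continuous_cyclicVariation_inner p).intervalIntegrable _ _) fun θ _ => ?_
    obtain ⟨i, hi⟩ := hvertex θ
    obtain ⟨j, hj⟩ := hvertex (θ + Real.pi)
    refine le_trans ?_ (two_mul_abs_sub_le_cyclicVariation _ i j)
    have := le_abs_self ((inner ℝ (Complex.exp (θ * Complex.I)) (p i) : ℝ) -
      inner ℝ (Complex.exp (θ * Complex.I)) (p j))
    have hneg : (inner ℝ (Complex.exp ((θ + Real.pi : ℝ) * Complex.I)) (p j) : ℝ) =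
        -inner ℝ (Complex.exp (θ * Complex.I)) (p j) := by rw [exp_add_pi, inner_neg_left]
    rw [hneg] at hj
    rw [width]
    linarith
  rw [intervalIntegral.integral_const_mul, intervalIntegral.integral_sub
    ((continuous_width hS).intervalIntegrable _ _) (by simp), integral_width hS,
    intervalIntegral.integral_const, smul_eq_mul] at h
  linarith

/-- **Cauchy's formula**: the perimeter is the integral of the support function. -/
theorem perimeter_eq_integral_supportFn (hS : IsCompact S) (hne : S.Nonempty) :
    perimeter S = ∫ θ in (0 : ℝ)..(2 * Real.pi), supportFn S (Complex.exp (θ * Complex.I)) := by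
  refine IsLUB.csSup_eq ⟨?_, fun b hb => le_of_forall_pos_le_add fun ε hε => ?_⟩ ?_
  · rintro _ ⟨n, p, hpS, hp, rfl⟩
    exact hp.polygonLength_le hS fun i => hS.isClosed.frontier_subset (hpS i)
  · obtain ⟨n, p, hpS, hp, hle⟩ := exists_isConvexPolygon_le_polygonLength hS hne
      (div_pos hε Real.two_pi_pos)
    rw [mul_div_cancel₀ _ Real.two_pi_pos.ne'] at hle
    linarith [hb ⟨n, p, hpS, hp, rfl⟩]
  · obtain ⟨n, p, hpS, hp, -⟩ := exists_isConvexPolygon_le_polygonLength hS hne one_pos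
    exact ⟨_, n, p, hpS, hp, rfl⟩

end Perimeter

section Gain

variable {W : Set ℂ}

lemma isGreatest_optimalGain (hW : IsCompact W) (hne : W.Nonempty) {N : ℕ} (h : Fin N → ℂ) :
    IsGreatest (gains W h) (optimalGain W h) := by
  have himage : gains W h = (fun w : Fin N → ℂ => ‖∑ n, w n * h n‖) '' Set.univ.pi fun _ => W := by
    ext g
    simp only [gains, Set.mem_ofPred_eq, Set.mem_image, Set.mem_univ_pi]
    exact exists_congr fun w => and_congr_right fun _ => eq_comm
  rw [optimalGain, himage]
  exact ((isCompact_univ_pi fun _ => hW).image (by fun_prop)).isGreatest_sSup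
    ((Set.univ_pi_nonempty_iff.2 fun _ => hne).image _)

lemma isGreatest_idealGain {N : ℕ} (h : Fin N → ℂ) :
    IsGreatest (gains {w : ℂ | ‖w‖ = 1} h) (idealGain h) := by
  constructor
  · refine ⟨fun n => Complex.exp ((-(h n).arg : ℝ) * Complex.I),
      fun n => Complex.norm_exp_ofReal_mul_I _, ?_⟩
    have : ∀ n, Complex.exp ((-(h n).arg : ℝ) * Complex.I) * h n = ((‖h n‖ : ℝ) : ℂ) := by
      intro n
      conv_lhs => rw [← Complex.norm_mul_exp_arg_mul_I (h n)]
      rw [mul_left_comm, ← Complex.exp_add]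
      simp
    rw [Finset.sum_congr rfl fun n _ => this n, ← Complex.ofReal_sum, Complex.norm_real,
      Real.norm_of_nonneg (Finset.sum_nonneg fun n _ => norm_nonneg _), idealGain]
  · rintro _ ⟨w, hw, rfl⟩
    refine (norm_sum_le _ _).trans (Finset.sum_le_sum fun n _ => ?_)
    rw [norm_mul, hw n, one_mul]

lemma inner_exp_mul_exp (θ α : ℝ) (w : ℂ) :
    inner ℝ (Complex.exp (θ * Complex.I)) (w * Complex.exp (α * Complex.I)) =
      (inner ℝ (Complex.exp ((θ - α : ℝ) * Complex.I)) w : ℝ) := by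
  simp only [inner_eq_re_mul_re_add_im_mul_im, Complex.mul_re, Complex.mul_im,
    Complex.exp_ofReal_mul_I_re, Complex.exp_ofReal_mul_I_im, Real.cos_sub, Real.sin_sub]
  ring

lemma sum_norm_mul_supportFn_le_optimalGain (hW : IsCompact W) (hne : W.Nonempty) {N : ℕ}
    (h : Fin N → ℂ) (θ : ℝ) :
    ∑ n, ‖h n‖ * supportFn W (Complex.exp ((θ + -(h n).arg : ℝ) * Complex.I)) ≤
      optimalGain W h := by
  choose w hwW hw using fun n => exists_inner_eq_supportFn hW hne
    (Complex.exp ((θ + -(h n).arg : ℝ) * Complex.I))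
  refine le_trans ?_ ((isGreatest_optimalGain hW hne h).2 ⟨w, hwW, rfl⟩)
  refine le_trans (le_of_eq ?_) ((real_inner_le_norm (Complex.exp (θ * Complex.I)) (∑ n, w n * h n)).trans_eq
    (by rw [Complex.norm_exp_ofReal_mul_I, one_mul]))
  rw [inner_sum]
  refine Finset.sum_congr rfl fun n _ => ?_
  rw [← hw n, ← sub_eq_add_neg, ← inner_exp_mul_exp, ← real_inner_smul_right, Complex.real_smul,
    mul_left_comm, Complex.norm_mul_exp_arg_mul_I]

/-- The optimal gain is at least the average support function times the ideal gain. -/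
lemma integral_supportFn_mul_idealGain_le (hW : IsCompact W) (hne : W.Nonempty) {N : ℕ}
    (h : Fin N → ℂ) :
    (∫ θ in (0 : ℝ)..(2 * Real.pi), supportFn W (Complex.exp (θ * Complex.I))) / (2 * Real.pi) *
      idealGain h ≤ optimalGain W h := by
  have hcont : ∀ n, Continuous fun θ : ℝ =>
      ‖h n‖ * supportFn W (Complex.exp ((θ + -(h n).arg : ℝ) * Complex.I)) := fun n =>
    ((continuous_supportFn_exp hW).comp (continuous_add_const (-(h n).arg))).const_mul _
  have hle : ∫ θ in (0 : ℝ)..(2 * Real.pi),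
      ∑ n, ‖h n‖ * supportFn W (Complex.exp ((θ + -(h n).arg : ℝ) * Complex.I)) ≤
        ∫ _ in (0 : ℝ)..(2 * Real.pi), optimalGain W h :=
    intervalIntegral.integral_mono_on (by positivity)
      ((continuous_finsetSum _ fun n _ => hcont n).intervalIntegrable _ _) (by simp)
      fun θ _ => sum_norm_mul_supportFn_le_optimalGain hW hne h θ
  rw [intervalIntegral.integral_finsetSum fun n _ => (hcont n).intervalIntegrable _ _] at hle
  simp_rw [intervalIntegral.integral_const_mul, integral_supportFn_exp_add] at hle
  rw [← Finset.sum_mul, intervalIntegral.integral_const, smul_eq_mul, sub_zero] at hle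
  rw [div_mul_eq_mul_div, div_le_iff₀ Real.two_pi_pos, idealGain]
  linarith

lemma norm_exp_sub_exp_le (θ φ : ℝ) :
    ‖Complex.exp (θ * Complex.I) - Complex.exp (φ * Complex.I)‖ ≤ |θ - φ| := by
  have : Complex.exp (θ * Complex.I) - Complex.exp (φ * Complex.I) =
      Complex.exp (φ * Complex.I) * (Complex.exp (Complex.I * (θ - φ : ℝ)) - 1) := by
    rw [mul_sub, ← Complex.exp_add]; push_cast; ring_nf
  rw [this, norm_mul, Complex.norm_exp_ofReal_mul_I, one_mul]
  exact Real.norm_exp_I_mul_ofReal_sub_one_le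

lemma supportFn_exp_le_add (hW : IsCompact W) (hne : W.Nonempty) (hdisc : W ⊆ {w : ℂ | ‖w‖ ≤ 1})
    (θ φ : ℝ) : supportFn W (Complex.exp (θ * Complex.I)) ≤
      supportFn W (Complex.exp (φ * Complex.I)) + |θ - φ| := by
  obtain ⟨w, hw, hwθ⟩ := exists_inner_eq_supportFn hW hne (Complex.exp (θ * Complex.I))
  have h1 := inner_le_supportFn hW hw (Complex.exp (φ * Complex.I))
  have h2 := (real_inner_le_norm (Complex.exp (θ * Complex.I) - Complex.exp (φ * Complex.I)) w).trans
    (mul_le_mul (norm_exp_sub_exp_le θ φ) (hdisc hw) (norm_nonneg _) (abs_nonneg _))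
  rw [inner_sub_left, hwθ] at h2
  linarith

lemma sum_supportFn_exp_mul_le (hW : IsCompact W) (hne : W.Nonempty)
    (hdisc : W ⊆ {w : ℂ | ‖w‖ ≤ 1}) {N : ℕ} (hN : 0 < N) (θ : ℝ) :
    ∑ k ∈ Finset.range N,
      supportFn W (Complex.exp ((θ + k * (2 * Real.pi / N) : ℝ) * Complex.I)) ≤
    N * ((∫ θ in (0 : ℝ)..(2 * Real.pi), supportFn W (Complex.exp (θ * Complex.I))) /
      (2 * Real.pi) + 2 * Real.pi / N) := by
  set H : ℝ → ℝ := fun θ => supportFn W (Complex.exp (θ * Complex.I)) with hH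
  set d : ℝ := 2 * Real.pi / N with hd
  have hN' : (0 : ℝ) < N := by exact_mod_cast hN
  have hdpos : 0 < d := div_pos Real.two_pi_pos hN'
  have hint : ∀ a b, IntervalIntegrable H MeasureTheory.volume a b := fun a b =>
    (continuous_supportFn_exp hW).intervalIntegrable a b
  have hstep : ∀ k : ℕ, d * (H (θ + k * d) - d) ≤
      ∫ x in (θ + k * d)..(θ + (k + 1 : ℕ) * d), H x := by
    intro k
    have hk : θ + (k + 1 : ℕ) * d - (θ + k * d) = d := by push_cast; ring
    have := intervalIntegral.integral_mono_on (μ := MeasureTheory.volume)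
      (f := fun _ => H (θ + k * d) - d) (g := H) (a := θ + k * d) (b := θ + (k + 1 : ℕ) * d)
      (by linarith) (by simp) (hint _ _) fun x hx => by
        have h1 := supportFn_exp_le_add hW hne hdisc (θ + k * d) x
        rw [abs_sub_comm, abs_of_nonneg (by linarith [hx.1])] at h1
        simp only [hH]
        linarith [hx.2]
    rwa [intervalIntegral.integral_const, smul_eq_mul, hk] at this
  have hsum := Finset.sum_le_sum fun k (_ : k ∈ Finset.range N) => hstep k
  rw [intervalIntegral.sum_integral_adjacent_intervals (a := fun k : ℕ => θ + k * d)
    fun k _ => hint _ _, ← Finset.mul_sum, Finset.sum_sub_distrib] at hsum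
  have hNd : N * d = 2 * Real.pi := by rw [hd]; field_simp
  simp only [Nat.cast_zero, zero_mul, add_zero, hNd, Finset.sum_const, Finset.card_range,
    nsmul_eq_mul] at hsum
  rw [integral_supportFn_exp_of_period] at hsum
  change ∑ k ∈ Finset.range N, H (θ + k * d) ≤ _
  rw [← hNd, mul_add, ← mul_div_assoc, mul_div_mul_left _ _ hN'.ne', ← sub_le_iff_le_add,
    le_div_iff₀ hdpos]
  rw [hNd]
  linarith

/-- The channel whose coefficients are the `N`-th roots of unity. -/
noncomputable def rootsChannel (N : ℕ) (k : Fin N) : ℂ :=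
  Complex.exp ((-(k * (2 * Real.pi / N)) : ℝ) * Complex.I)

lemma idealGain_rootsChannel (N : ℕ) : idealGain (rootsChannel N) = N := by
  simp [idealGain, rootsChannel, Complex.norm_exp_ofReal_mul_I, -Complex.ofReal_neg]

lemma optimalGain_rootsChannel_le (hW : IsCompact W) (hne : W.Nonempty)
    (hdisc : W ⊆ {w : ℂ | ‖w‖ ≤ 1}) {N : ℕ} (hN : 0 < N) :
    optimalGain W (rootsChannel N) ≤
      N * ((∫ θ in (0 : ℝ)..(2 * Real.pi), supportFn W (Complex.exp (θ * Complex.I))) /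
        (2 * Real.pi) + 2 * Real.pi / N) := by
  obtain ⟨w, hw, hwg⟩ := (isGreatest_optimalGain hW hne (rootsChannel N)).1
  set z := ∑ n, w n * rootsChannel N n with hz
  have hinner : ‖z‖ = inner ℝ (Complex.exp (z.arg * Complex.I)) z := by
    rw [inner_exp, sub_self, Real.cos_zero, mul_one]
  rw [hwg, hinner]
  refine le_trans ?_ (sum_supportFn_exp_mul_le hW hne hdisc hN z.arg)
  rw [← Fin.sum_univ_eq_sum_range fun k => supportFn W
    (Complex.exp ((z.arg + k * (2 * Real.pi / N) : ℝ) * Complex.I))]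
  nth_rewrite 2 [hz]
  rw [inner_sum]
  refine Finset.sum_le_sum fun k _ => ?_
  rw [rootsChannel, inner_exp_mul_exp, sub_neg_eq_add]
  exact inner_le_supportFn hW (hw k) _

end Gain

section Decibel

lemma decibel_mono : Monotone decibel := by
  intro r s hrs
  rcases le_or_gt r 0 with hr | hr
  · rw [decibel, if_pos hr]; exact bot_le
  · rw [decibel, decibel, if_neg hr.not_ge, if_neg (hr.trans_le hrs).not_ge, EReal.coe_le_coe_iff]
    have := Real.logb_le_logb_of_le (b := 10) (by norm_num) hr hrs
    linarith

lemma exists_pos_decibel_add_lt {c : ℝ} {x : EReal} (hx : decibel c < x) :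
    ∃ δ > 0, decibel (c + δ) < x := by
  obtain ⟨y, hcy, hyx⟩ := EReal.lt_iff_exists_real_btwn.1 hx
  have hpow : (0 : ℝ) < 10 ^ (y / 20) := Real.rpow_pos_of_pos (by norm_num) _
  have hval : decibel (10 ^ (y / 20)) = y := by
    rw [decibel, if_neg hpow.not_ge, Real.logb_rpow (by norm_num) (by norm_num),
      mul_div_cancel₀ _ (by norm_num)]
  have hc : c < 10 ^ (y / 20) := by
    by_contra! hle
    exact absurd hcy (not_lt.2 (hval ▸ decibel_mono hle))
  refine ⟨10 ^ (y / 20) - c, sub_pos.2 hc, ?_⟩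
  rwa [add_sub_cancel, hval]

end Decibel

end Beamforming

theorem mainTheorem2 (W : Set ℂ) (hW : IsCompact W) (hne : W.Nonempty)
    (hdisc : W ⊆ {w : ℂ | ‖w‖ ≤ 1}) :
    -- Cauchy's formula: mean width = perimeter / π
    Beamforming.meanWidth (convexHull ℝ W) =
        Beamforming.perimeter (convexHull ℝ W) / Real.pi ∧
    -- the averaged support function of `W` is perimeter / 2π
    1 / (2 * Real.pi) * ∫ θ in (0 : ℝ)..(2 * Real.pi),
          Beamforming.supportFn W (Complex.exp (θ * Complex.I)) =
        Beamforming.perimeter (convexHull ℝ W) / (2 * Real.pi) ∧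
    -- for every channel: both optimal gains are attained maxima, and the universal bound holds
    (∀ (N : ℕ) (h : Fin N → ℂ),
      IsGreatest (Beamforming.gains W h) (Beamforming.optimalGain W h) ∧
      IsGreatest (Beamforming.gains {w : ℂ | ‖w‖ = 1} h) (Beamforming.idealGain h) ∧
      Beamforming.optimalGain W h ≥
        Beamforming.perimeter (convexHull ℝ W) / (2 * Real.pi) * Beamforming.idealGain h) ∧
    -- the worst-case shortfall in dB over all channels
    IsGLB {s : EReal | ∃ (N : ℕ) (h : Fin N → ℂ), 0 < Beamforming.idealGain h ∧
        s = Beamforming.decibel (Beamforming.optimalGain W h / Beamforming.idealGain h)}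
      (Beamforming.decibel (Beamforming.perimeter (convexHull ℝ W) / (2 * Real.pi))) := by
  have hperK := Beamforming.perimeter_eq_integral_supportFn hW.convexHull_real hne.convexHull
  have hper : Beamforming.perimeter (convexHull ℝ W) =
      ∫ θ in (0 : ℝ)..(2 * Real.pi), Beamforming.supportFn W (Complex.exp (θ * Complex.I)) := by
    simp_rw [hperK, Beamforming.supportFn_convexHull hW hne]
  have hbound : ∀ (N : ℕ) (h : Fin N → ℂ),
      Beamforming.perimeter (convexHull ℝ W) / (2 * Real.pi) * Beamforming.idealGain h ≤ Beamforming.optimalGain W h := fun N h =>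
    hper ▸ Beamforming.integral_supportFn_mul_idealGain_le hW hne h
  refine ⟨?_, ?_, fun N h => ⟨Beamforming.isGreatest_optimalGain hW hne h, Beamforming.isGreatest_idealGain h,
    hbound N h⟩, ?_, ?_⟩
  · rw [Beamforming.meanWidth, Beamforming.integral_width hW.convexHull_real, ← hperK]
    field_simp
  · rw [hper, one_div_mul_eq_div]
  · rintro _ ⟨N, h, hpos, rfl⟩
    exact Beamforming.decibel_mono ((le_div_iff₀ hpos).2 (hbound N h))
  · intro b hb
    refine le_of_forall_gt_imp_ge_of_dense fun x hx => ?_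
    obtain ⟨δ, hδ, hlt⟩ := Beamforming.exists_pos_decibel_add_lt hx
    obtain ⟨N, hN⟩ := exists_nat_gt (2 * Real.pi / δ)
    have hN0 : (0 : ℝ) < N := (div_pos Real.two_pi_pos hδ).trans hN
    have hpos : 0 < Beamforming.idealGain (Beamforming.rootsChannel N) := by rwa [Beamforming.idealGain_rootsChannel]
    refine (hb ⟨N, Beamforming.rootsChannel N, hpos, rfl⟩).trans ((Beamforming.decibel_mono ?_).trans hlt.le)
    rw [Beamforming.idealGain_rootsChannel, div_le_iff₀ hN0, hper, mul_comm]
    refine (Beamforming.optimalGain_rootsChannel_le hW hne hdisc (Nat.cast_pos.1 hN0)).trans ?_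
    have : 2 * Real.pi / N ≤ δ := (div_le_comm₀ hN0 hδ).2 hN.le
    gcongr
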